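/- For an elliptic curve $E/\mathbb Q$ let $E[N]$ be the group of points of $E(\overline{\mathbb Q})$ of order dividing $N$, and let $G_{\mathbb Q}=\operatorname{Gal}(\overline{\mathbb Q}/\mathbb Q)$. Given a basis $\{P,Q\}$ of $E[N]$ over $\mathbb Z/N\mathbb Z$, let $\overline\rho_{E,N}\colon G_{\mathbb Q}\to \operatorname{GL}(2,\mathbb Z/N\mathbb Z)$ send $\sigma$ to $\begin{bmatrix} A & C\\ B & D\end{bmatrix}$, where $\sigma(P)=[A]P+[B]Q$ and $\sigma(Q)=[C]P+[D]Q$; another basis replaces the image by a conjugate subgroup. For a finite subgroup $H\subseteq E(\overline{\mathbb Q})$ that is stable under $G_{\mathbb Q}$ and cyclic, $E/H$ denotes an elliptic curve over $\mathbb Q$ that is the target of an isogeny from $E$, defined over $\mathbb Q$, with kernel $H$. **Lemma.** Let $E/\mathbb Q$ be an elliptic curve all of whose points of order $2$ are defined over $\mathbb Q$, and let $P_2\neq Q_2$ be two points of order $2$ on $E$. Then there is a basis $\{P_{64},Q_{64}\}$ of $E[64]$ with $[32]P_{64}=P_2$ and $[32]Q_{64}=Q_2$. For every such basis, $\overline\rho_{E,64}(G_{\mathbb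 Q})$ is generated by the reductions modulo $64$ of finitely many integer matrices $$\begin{bmatrix} A_1 & C_1\\ B_1 & D_1\end{bmatrix},\ \ldots,\ \begin{bmatrix} A_s & C_s\\ B_s & D_s\end{bmatrix},$$ and whenever integer matrices generate it in this way, all $A_i$, $D_i$ are odd, all $B_i$, $C_i$ are even, and: 1. $\overline\rho_{E/\langle Q_2\rangle,32}(G_{\mathbb Q})$ is conjugate in $\operatorname{GL}(2,\mathbb Z/32\mathbb Z)$ to the subgroup generated by the matrices $\begin{bmatrix} A_i & \frac{C_i}{2}\\ 2B_i & D_i\end{bmatrix}$, $1\le i\le s$; 2. $\overline\rho_{E/\langle P_2\rangle,32}(G_{\mathbb Q})$ is conjugate in $\operatorname{GL}(2,\mathbb Z/32\mathbb Z)$ to the subgroup generated by the matrices $\begin{bmatrix} D_i & \frac{B_i}{2}\\ 2C_i & A_i\end{bmatrix}$, $1\le i\le s$; 3. $\overline\rho_{E/\langle P_2+Q_2\rangle,32}(G_{\mathbb Q})$ is conjugate in $\operatorname{GL}(2,\mathbb Z/32\mathbb Z)$ to the subgroup generated by the matrices $\begin{bmatrix} A_i-B_i & \frac{A_i+C_i-B_i-D_i}{2}\\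 2B_i & B_i+D_i\end{bmatrix}$, $1\le i\le s$. -/

import Mathlib

namespace EllipticGalois

open WeierstrassCurve

/-- The fixed algebraic closure of the field of rational numbers. -/
abbrev QBar : Type := AlgebraicClosure ℚ

/-- The absolute Galois group of the field of rational numbers. -/
abbrev GQ : Type := QBar ≃ₐ[ℚ] QBar

noncomputable instance : DecidableEq QBar := Classical.decEq QBar

/-- The group of points of the curve `E` over the rationals with coordinates in the algebraic
closure, together with the point at infinity. -/
abbrev GeomPoint (E : WeierstrassCurve ℚ) : Type := (Affine.baseChange E QBar).Point

/-- A geometric point is defined over the rationals if it comes from a rational point. -/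
def IsRational (E : WeierstrassCurve ℚ) (P : GeomPoint E) : Prop :=
  P ∈ Set.range (Affine.Point.map (W' := E) (Algebra.ofId ℚ QBar))

/-- The action of a Galois automorphism on the geometric points, coordinate by coordinate. -/
noncomputable def galAct (E : WeierstrassCurve ℚ) (σ : GQ) : GeomPoint E →+ GeomPoint E :=
  Affine.Point.map (W' := E) (σ : QBar →ₐ[ℚ] QBar)

/-- `E[N]`: the group of geometric points of order dividing `N`. -/
noncomputable abbrev Tors (E : WeierstrassCurve ℚ) (N : ℕ) : AddSubgroup (GeomPoint E) :=
  AddSubgroup.torsionBy (GeomPoint E) (N : ℤ)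

noncomputable instance (E : WeierstrassCurve ℚ) (N : ℕ) : Module (ZMod N) (Tors E N) :=
  AddSubgroup.torsionBy.zmodModule

/-- A Galois automorphism as a `ℤ/N`-linear endomorphism of `E[N]`. -/
noncomputable def torsAct (E : WeierstrassCurve ℚ) (N : ℕ) (σ : GQ) :
    Module.End (ZMod N) (Tors E N) :=
  AddMonoidHom.toZModLinearMap N
    (((galAct E σ).comp (Tors E N).subtype).codRestrict (Tors E N) (fun P => by
      rw [AddSubgroup.torsionBy.nsmul_iff, AddMonoidHom.comp_apply, ← map_nsmul, ← map_nsmul,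
        AddSubgroup.torsionBy.nsmul P, map_zero, map_zero]))

/-- The action of the absolute Galois group on `E[N]`. -/
noncomputable def torsRep (E : WeierstrassCurve ℚ) (N : ℕ) :
    GQ →* Module.End (ZMod N) (Tors E N) where
  toFun := torsAct E N
  map_one' := by
    ext P
    exact congrArg Subtype.val (show torsAct E N 1 P = P from Subtype.ext (by
      change galAct E 1 P.1 = P.1
      rcases P.1 with _ | _ <;> rfl))
  map_mul' σ τ := by
    ext P
    change galAct E (σ * τ) P.1 = galAct E σ (galAct E τ P.1)
    rcases P.1 with _ | _ <;> rfl

/-- The mod-`N` Galois representation of `E` in a given basis `{P, Q}` of `E[N]`. If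
`σ P = A P + B Q` and `σ Q = C P + D Q`, then `σ` is sent to the matrix with columns
`(A, B)` and `(C, D)`. -/
noncomputable def matRep (E : WeierstrassCurve ℚ) (N : ℕ)
    (b : Module.Basis (Fin 2) (ZMod N) (Tors E N)) : GQ →* GL (Fin 2) (ZMod N) :=
  (Units.map (LinearMap.toMatrixAlgEquiv b : _ →* Matrix (Fin 2) (Fin 2) (ZMod N))).comp
    (torsRep E N).toHomUnits

/-- The image of the mod-`N` Galois representation of `E` in a given basis of `E[N]`. -/
noncomputable def galImage (E : WeierstrassCurve ℚ) (N : ℕ)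
    (b : Module.Basis (Fin 2) (ZMod N) (Tors E N)) : Subgroup (GL (Fin 2) (ZMod N)) :=
  (matRep E N b).range

/-- The integer matrices `M i` are all invertible modulo `N`, and their reductions modulo `N`
generate the subgroup `H` of `GL(2, ℤ/N)`. -/
def IsGeneratedBy {ι : Type} (N : ℕ) (H : Subgroup (GL (Fin 2) (ZMod N)))
    (M : ι → Matrix (Fin 2) (Fin 2) ℤ) : Prop :=
  ∃ g : ι → GL (Fin 2) (ZMod N),
    (∀ i, (g i : Matrix (Fin 2) (Fin 2) (ZMod N)) = (M i).map (Int.cast : ℤ → ZMod N)) ∧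
      H = Subgroup.closure (Set.range g)

/-- `E[N]` has a basis, and in every basis the image of the mod-`N` Galois representation of `E` is
conjugate in `GL(2, ℤ/N)` to the subgroup generated by the reductions of the integer
matrices `M i`. -/
def HasImageConjTo {ι : Type} (E : WeierstrassCurve ℚ) (N : ℕ)
    (M : ι → Matrix (Fin 2) (Fin 2) ℤ) : Prop :=
  Nonempty (Module.Basis (Fin 2) (ZMod N) (Tors E N)) ∧
    ∀ b : Module.Basis (Fin 2) (ZMod N) (Tors E N), ∃ g : GL (Fin 2) (ZMod N),
      IsGeneratedBy N ((galImage E N b).map (MulAut.conj g).toMonoidHom) M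

/-- Homogeneous coordinates of a geometric point in the projective plane. -/
noncomputable def projCoords (E : WeierstrassCurve ℚ) : GeomPoint E → Fin 3 → QBar
  | .zero => ![0, 1, 0]
  | .some x y _ => ![x, y, 1]

/-- A map on geometric points is a morphism of projective curves over the rationals: around
each point it is given by homogeneous polynomials of one degree with rational coefficients. -/
def IsMorphism (E E' : WeierstrassCurve ℚ) (f : GeomPoint E → GeomPoint E') : Prop :=
  ∀ P : GeomPoint E, ∃ (d : ℕ) (F : Fin 3 → MvPolynomial (Fin 3) ℚ),
    (∀ i, (F i).IsHomogeneous d) ∧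
    (∃ i, MvPolynomial.aeval (projCoords E P) (F i) ≠ 0) ∧
    ∀ R : GeomPoint E, (∃ i, MvPolynomial.aeval (projCoords E R) (F i) ≠ 0) →
      ∃ c : QBar, ∀ i, MvPolynomial.aeval (projCoords E R) (F i) = c * projCoords E' (f R) i

/-- An isogeny defined over the rationals: a nonzero homomorphism of groups of geometric points
that is a morphism of projective curves over the rationals. -/
structure Isogeny (E E' : WeierstrassCurve ℚ) where
  /-- the map on geometric points -/
  toHom : GeomPoint E →+ GeomPoint E'
  ne_zero : toHom ≠ 0
  isMorphism : IsMorphism E E' toHom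

/-- `E'` is a model over the rationals of the quotient `E / H`: it is the target of an isogeny
from `E`, defined over the rationals, with kernel `H`. -/
def IsQuotientBy (E : WeierstrassCurve ℚ) (H : AddSubgroup (GeomPoint E))
    (E' : WeierstrassCurve ℚ) : Prop :=
  ∃ φ : Isogeny E E', φ.toHom.ker = H

end EllipticGalois

/-! Let `P, Q` be a basis of `E[2N]` and `φ` a rational isogeny with kernel `⟨N Q⟩`. Then `φ(2P),
φ(Q)` is a basis of `E'[N]`. If `σP = A P + B Q` and `σQ = C P + D Q` with `C` even, then `σ(2P) = A
(2P) + 2B Q` and `σQ = (C/2)(2P) + D Q`. Since `φ` commutes with `σ`, applying it gives the first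
matrix (`hasImageConjTo_of_isQuotientBy`). The other two quotients are the same case in the bases
`{Q, P}` and `{P, P + Q}`, by `IsGeneratedBy.change_basis`. The entries have the required parity
because Galois fixes `N P` and `N Q`.

Generators pass between curves as Galois automorphisms: `isGeneratedBy_galImage_iff` replaces
generating matrices by automorphisms, which depend on neither the curve nor the basis.

Bases come from a counting argument: `E[2^n]` has at most `4^n` elements, so two independent points
killed by `2^n` span it. On `E`, such points are found by halving `P₂` and `Q₂` repeatedly over the
algebraically closed field. -/

/-! ### The duplication map: surjectivity and size of its kernel. -/

namespace WeierstrassCurve.Affine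

open Polynomial

variable {F : Type*} [Field F] [DecidableEq F] (W : Affine F)

/-- The resultant identity between the numerator and the denominator of the duplication map. -/
lemma duplication_bezout {R : Type*} [CommRing R] (W : WeierstrassCurve R) (x : R) :
    (12 * x ^ 3 - W.b₂ * x ^ 2 - 10 * W.b₄ * x + W.b₂ * W.b₄ - 27 * W.b₆) *
      (4 * x ^ 3 + W.b₂ * x ^ 2 + 2 * W.b₄ * x + W.b₆) -
    (48 * x ^ 2 + 8 * W.b₂ * x + 32 * W.b₄ - W.b₂ ^ 2) *
      (x ^ 4 - W.b₄ * x ^ 2 - 2 * W.b₆ * x - W.b₈) = W.Δ := by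
  rw [Δ]
  -- The difference of the two sides is a multiple of `4 * b₈ = b₂ * b₆ - b₄ ^ 2`.
  linear_combination (12 * x ^ 2 + 2 * W.b₂ * x + 8 * W.b₄) * W.b_relation

variable {W}

omit [DecidableEq F] in
lemma sq_sub_negY {x y : F} (h : W.Equation x y) :
    (y - W.negY x y) ^ 2 = 4 * x ^ 3 + W.b₂ * x ^ 2 + 2 * W.b₄ * x + W.b₆ := by
  rw [equation_iff] at h
  simp only [negY, b₂, b₄, b₆]
  linear_combination 4 * h

/-- The tangent formula with its denominator cleared: prescribing the abscissa of `2T` becomes a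
quartic equation in that of `T`. -/
lemma addX_self_mul {x y : F} (h : W.Equation x y) (hy : y ≠ W.negY x y) :
    W.addX x x (W.slope x x y y) * (4 * x ^ 3 + W.b₂ * x ^ 2 + 2 * W.b₄ * x + W.b₆) =
      x ^ 4 - W.b₄ * x ^ 2 - 2 * W.b₆ * x - W.b₈ := by
  have hy' : y - W.negY x y ≠ 0 := sub_ne_zero.2 hy
  rw [← sq_sub_negY h, slope_of_Y_ne rfl hy, addX]
  field_simp
  rw [equation_iff] at h
  simp only [negY, b₄, b₆, b₈]
  linear_combination (-W.a₁ ^ 2 - 4 * W.a₂ - 8 * x) * h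

namespace Point

/-- Multiplication by two is surjective on the points of an elliptic curve over an
algebraically closed field. -/
theorem exists_two_nsmul_eq [IsAlgClosed F] [W.IsElliptic] (P : W.Point) :
    ∃ T : W.Point, 2 • T = P := by
  rcases P with _ | ⟨x₀, y₀, h₀⟩
  · exact ⟨0, smul_zero 2⟩
  obtain ⟨x, hx⟩ : ∃ x, x ^ 4 - W.b₄ * x ^ 2 - 2 * W.b₆ * x - W.b₈ =
      x₀ * (4 * x ^ 3 + W.b₂ * x ^ 2 + 2 * W.b₄ * x + W.b₆) := by
    obtain ⟨x, hx⟩ := IsAlgClosed.exists_root (X ^ 4 + (C (-4 * x₀) * X ^ 3 +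
      C (-W.b₄ - x₀ * W.b₂) * X ^ 2 + C (-2 * W.b₆ - 2 * x₀ * W.b₄) * X +
      C (-W.b₈ - x₀ * W.b₆)) : F[X]) (by
        rw [degree_add_eq_left_of_degree_lt]
        · simp
        · rw [degree_X_pow]
          exact degree_cubic_lt)
    refine ⟨x, ?_⟩
    simp only [IsRoot, eval_add, eval_mul, eval_pow, eval_X, eval_C] at hx
    linear_combination hx
  -- If the denominator vanished, so would the numerator, and the resultant identity would give `Δ =
  -- 0`.
  have hΨ : 4 * x ^ 3 + W.b₂ * x ^ 2 + 2 * W.b₄ * x + W.b₆ ≠ 0 := fun h => by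
    have hΔ := duplication_bezout W x
    rw [hx, h, mul_zero, mul_zero, mul_zero, sub_zero] at hΔ
    exact W.isUnit_Δ.ne_zero hΔ.symm
  obtain ⟨y, hy⟩ : ∃ y, W.Equation x y := by
    obtain ⟨y, hy⟩ := IsAlgClosed.exists_root (X ^ 2 + (C (W.a₁ * x + W.a₃) * X +
      C (-(x ^ 3 + W.a₂ * x ^ 2 + W.a₄ * x + W.a₆))) : F[X]) (by
        rw [degree_add_eq_left_of_degree_lt]
        · simp
        · rw [degree_X_pow]
          exact degree_linear_lt)
    refine ⟨y, ?_⟩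
    simp only [IsRoot, eval_add, eval_mul, eval_pow, eval_X, eval_C] at hy
    rw [equation_iff]
    linear_combination hy
  have hne : y ≠ W.negY x y := fun h => hΨ (by rw [← sq_sub_negY hy, sub_eq_zero.2 h, sq, zero_mul])
  have hX : W.addX x x (W.slope x x y y) = x₀ :=
    mul_right_cancel₀ hΨ ((addX_self_mul hy hne).trans hx)
  have hT := add_self_of_Y_ne (h₁ := equation_iff_nonsingular.1 hy) hne
  rw [← two_nsmul] at hT
  -- Equal abscissas give `2T = P` or `2T = -P`; in the second case `-T` works.
  rcases X_eq_iff (h₂ := h₀) |>.1 hX with h | h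
  · exact ⟨_, hT.trans h⟩
  · exact ⟨-some x y (equation_iff_nonsingular.1 hy), by rw [smul_neg, hT, h, neg_neg]⟩

/-- There are at most four points of order dividing two. -/
theorem two_torsion_finite_and_ncard_le (h2 : (2 : F) ≠ 0) :
    {T : W.Point | 2 • T = 0}.Finite ∧ {T : W.Point | 2 • T = 0}.ncard ≤ 4 := by
  set p : F[X] := C 4 * X ^ 3 + C W.b₂ * X ^ 2 + C (2 * W.b₄) * X + C W.b₆
  have h4 : (4 : F) ≠ 0 := by
    rw [show (4 : F) = 2 * 2 by norm_num]
    exact mul_ne_zero h2 h2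
  have hp : p ≠ 0 := ne_zero_of_natDegree_gt (n := 0) (by rw [natDegree_cubic h4]; norm_num)
  let f : W.Point → Option F
    | .zero => none
    | .some x _ _ => Option.some x
  have hmaps : ∀ T ∈ {T : W.Point | 2 • T = 0}, f T ∈ (p.roots.toFinset.insertNone : Set (Option F)) := by
    rintro (_ | ⟨x, y, h⟩) hT
    · simp [f]
    · have hy : y = W.negY x y := by
        by_contra hne
        rw [Set.mem_ofPred_eq, two_nsmul, add_self_of_Y_ne hne] at hT
        exact some_ne_zero _ hT
      have := sq_sub_negY h.1
      rw [sub_eq_zero.2 hy] at this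
      simp only [f, Finset.mem_coe, Finset.some_mem_insertNone, Multiset.mem_toFinset,
        mem_roots hp, IsRoot, p, eval_add, eval_mul, eval_pow, eval_X, eval_C]
      rw [← this]
      ring
  -- The abscissa determines a point up to sign, and `-T = T` on the kernel.
  have hinj : Set.InjOn f {T : W.Point | 2 • T = 0} := by
    rintro (_ | ⟨x, y, h⟩) hT (_ | ⟨x', y', h'⟩) hT' hf
    · rfl
    · simp [f] at hf
    · simp [f] at hf
    · rcases X_eq_iff (h₁ := h) (h₂ := h') |>.1 (Option.some.inj hf) with e | e
      · exact e
      · rw [e]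
        rw [Set.mem_ofPred_eq, two_nsmul] at hT'
        exact neg_eq_of_add_eq_zero_left hT'
  refine ⟨Set.Finite.of_finite_image ((Finset.finite_toSet _).subset
    (Set.image_subset_iff.2 hmaps)) hinj, ?_⟩
  refine (Set.ncard_le_ncard_of_injOn f hmaps hinj (Finset.finite_toSet _)).trans ?_
  rw [Set.ncard_coe_finset, Finset.card_insertNone]
  have h3 : p.roots.toFinset.card ≤ 3 :=
    (Multiset.toFinset_card_le _).trans ((card_roots' p).trans natDegree_cubic_le)
  omega

end Point

end WeierstrassCurve.Affine

/-! ### Counting `2`-power torsion, and bases. -/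

namespace EllipticGalois

open WeierstrassCurve

/-- If the kernel of multiplication by two has at most four elements, then the kernel of
multiplication by `2 ^ n` has at most `4 ^ n` elements. -/
lemma finite_and_ncard_two_pow_le {A : Type*} [AddCommGroup A]
    (h : {T : A | 2 • T = 0}.Finite ∧ {T : A | 2 • T = 0}.ncard ≤ 4) (n : ℕ) :
    {T : A | 2 ^ n • T = 0}.Finite ∧ {T : A | 2 ^ n • T = 0}.ncard ≤ 4 ^ n := by
  induction n with
  | zero => simp
  | succ n ih =>
    classical
    obtain ⟨hf, hc⟩ := ih
    -- A fibre of doubling is empty or a translate of its kernel.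
    have hfib : ∀ R : A, {T : A | 2 • T = R}.Finite ∧ {T : A | 2 • T = R}.ncard ≤ 4 := by
      intro R
      rcases Set.eq_empty_or_nonempty {T : A | 2 • T = R} with e | ⟨T₀, hT₀⟩
      · simp [e]
      · have he : {T : A | 2 • T = R} = (fun T => T + T₀) '' {T : A | 2 • T = 0} := by
          ext T
          simp only [Set.mem_ofPred_eq, Set.mem_image] at hT₀ ⊢
          exact ⟨fun hT => ⟨T - T₀, by rw [smul_sub, hT, hT₀, sub_self], sub_add_cancel _ _⟩,
            fun ⟨S, hS, e⟩ => by rw [← e, smul_add, hS, hT₀, zero_add]⟩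
        rw [he]
        exact ⟨h.1.image _, (Set.ncard_image_le h.1).trans h.2⟩
    have hu : {T : A | 2 ^ (n + 1) • T = 0} =
        ⋃ R ∈ hf.toFinset, {T : A | 2 • T = R} := by
      ext T
      simp [pow_succ, mul_smul]
    refine ⟨?_, ?_⟩
    · rw [hu]
      exact Set.Finite.biUnion (Finset.finite_toSet _) fun R _ => (hfib R).1
    · rw [hu]
      refine (Finset.set_ncard_biUnion_le _ _).trans ?_
      refine (Finset.sum_le_card_nsmul _ _ 4 fun R _ => (hfib R).2).trans ?_
      rw [← Set.ncard_eq_toFinset_card _ hf, smul_eq_mul, pow_succ]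
      exact Nat.mul_le_mul_right _ hc

/-- Points `P`, `Q` whose multiples by `2 ^ k` are distinct of order two are independent
modulo `2 ^ (k + 1)`. -/
lemma two_pow_dvd_of_zsmul_add_zsmul_eq_zero {A : Type*} [AddCommGroup A] {k : ℕ} {P Q : A}
    (hP : addOrderOf (2 ^ k • P) = 2) (hQ : addOrderOf (2 ^ k • Q) = 2)
    (hPQ : 2 ^ k • P ≠ 2 ^ k • Q) {a b : ℤ} (h : a • P + b • Q = 0) :
    (2 : ℤ) ^ (k + 1) ∣ a ∧ (2 : ℤ) ^ (k + 1) ∣ b := by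
  have h2 : ∀ {T : A}, addOrderOf T = 2 → 2 • T = 0 := fun {T} hT => hT ▸ addOrderOf_nsmul_eq_zero T
  -- Distinct points of order two are linearly independent over the field with two elements.
  have key : ∀ {S T : A}, addOrderOf S = 2 → addOrderOf T = 2 → S ≠ T → ∀ {a b : ℤ},
      a • S + b • T = 0 → Even a ∧ Even b := by
    intro S T hS hT hST a b hab
    have hS0 : S ≠ 0 := by rintro rfl; simp at hS
    have hT0 : T ≠ 0 := by rintro rfl; simp at hT
    have e : ∀ {T : A}, addOrderOf T = 2 → ∀ c : ℤ, (c + c) • T = 0 := fun {T} hT c => by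
      rw [← two_mul, mul_comm, mul_smul, ofNat_zsmul, h2 hT, smul_zero]
    rcases Int.even_or_odd a with ha | ⟨c, rfl⟩ <;> rcases Int.even_or_odd b with hb | ⟨d, rfl⟩
    · exact ⟨ha, hb⟩
    · obtain ⟨c, rfl⟩ := ha
      rw [e hS, zero_add, add_smul, two_mul, e hT, zero_add, one_smul] at hab
      exact absurd hab hT0
    · obtain ⟨d, rfl⟩ := hb
      rw [e hT, add_zero, add_smul, two_mul, e hS, zero_add, one_smul] at hab
      exact absurd hab hS0
    · rw [add_smul, add_smul, two_mul, two_mul, e hT, e hS, zero_add, zero_add, one_smul,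
        one_smul] at hab
      have hTT : T + T = 0 := by rw [← two_nsmul, h2 hT]
      exact absurd (add_right_cancel (hab.trans hTT.symm)) hST
  suffices H : ∀ j ≤ k + 1, (2 : ℤ) ^ j ∣ a ∧ (2 : ℤ) ^ j ∣ b from H _ le_rfl
  intro j
  induction j with
  | zero => simp
  | succ j ih =>
    intro hj
    obtain ⟨⟨a', rfl⟩, ⟨b', rfl⟩⟩ := ih (by omega)
    -- With `2 ^ j` already extracted from both coefficients, multiplying the relation by `2 ^ (k -
    -- j)` turns it into one between the points of order two.
    have h' : a' • (2 ^ k • P) + b' • (2 ^ k • Q) = 0 := by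
      have := congrArg (fun T => (2 ^ (k - j) : ℤ) • T) h
      have hk : (2 : ℤ) ^ k = 2 ^ (k - j) * 2 ^ j := by rw [← pow_add]; congr 1; omega
      simp only [smul_add, smul_smul, smul_zero] at this
      rw [← natCast_zsmul, ← natCast_zsmul, smul_smul, smul_smul]
      push_cast
      rw [hk, ← this]
      congr 2 <;> ring
    obtain ⟨ha, hb⟩ := key hP hQ hPQ h'
    rw [pow_succ]
    exact ⟨mul_dvd_mul_left _ ha.two_dvd, mul_dvd_mul_left _ hb.two_dvd⟩

lemma mem_Tors {E : WeierstrassCurve ℚ} {N : ℕ} {T : GeomPoint E} :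
    T ∈ Tors E N ↔ N • T = 0 :=
  AddSubgroup.torsionBy.nsmul_iff.symm

lemma coe_intCast_smul {E : WeierstrassCurve ℚ} {N : ℕ} (a : ℤ) (T : Tors E N) :
    (((a : ZMod N) • T : Tors E N) : GeomPoint E) = a • (T : GeomPoint E) := by
  rw [Int.cast_smul_eq_zsmul, AddSubgroup.coe_zsmul]

lemma finite_and_card_tors_le (E : WeierstrassCurve ℚ) (n : ℕ) :
    Finite (Tors E (2 ^ n)) ∧ Nat.card (Tors E (2 ^ n)) ≤ 4 ^ n := by
  have h := finite_and_ncard_two_pow_le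
    (Affine.Point.two_torsion_finite_and_ncard_le (W := Affine.baseChange E QBar) two_ne_zero) n
  have e : {T : GeomPoint E | 2 ^ n • T = 0} = (Tors E (2 ^ n) : Set (GeomPoint E)) := by
    ext T
    exact mem_Tors.symm
  rw [e] at h
  exact ⟨h.1, h.2⟩

/-- Two independent points of order `2 ^ n` form a basis of `E[2 ^ n]`. -/
lemma exists_basis_of_independent (E : WeierstrassCurve ℚ) {N n : ℕ} (hN : N = 2 ^ n)
    {P Q : GeomPoint E} (hP : N • P = 0) (hQ : N • Q = 0)
    (h : ∀ a b : ℤ, a • P + b • Q = 0 → (N : ℤ) ∣ a ∧ (N : ℤ) ∣ b) :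
    ∃ b : Module.Basis (Fin 2) (ZMod N) (Tors E N),
      (b 0 : GeomPoint E) = P ∧ (b 1 : GeomPoint E) = Q := by
  subst hN
  obtain ⟨hfin, hcard⟩ := finite_and_card_tors_le E n
  let P' : Tors E (2 ^ n) := ⟨P, mem_Tors.2 hP⟩
  let Q' : Tors E (2 ^ n) := ⟨Q, mem_Tors.2 hQ⟩
  have hli : LinearIndependent (ZMod (2 ^ n)) ![P', Q'] := by
    rw [LinearIndependent.pair_iff]
    intro s t hst
    obtain ⟨a, rfl⟩ := ZMod.intCast_surjective s
    obtain ⟨b, rfl⟩ := ZMod.intCast_surjective t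
    have := congrArg Subtype.val hst
    rw [AddSubgroup.coe_add, coe_intCast_smul, coe_intCast_smul] at this
    rw [ZMod.intCast_zmod_eq_zero_iff_dvd, ZMod.intCast_zmod_eq_zero_iff_dvd]
    exact h a b this
  have hinj : Function.Injective (Fintype.linearCombination (ZMod (2 ^ n)) ![P', Q']) :=
    linearIndependent_iff_injective_fintypeLinearCombination.1 hli
  -- An injection from a set of `4 ^ n` elements into one of at most `4 ^ n` is onto, so the upper
  -- bound on the torsion suffices.
  have hbij : Function.Bijective (Fintype.linearCombination (ZMod (2 ^ n)) ![P', Q']) := by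
    refine hinj.bijective_of_nat_card_le (hcard.trans ?_)
    rw [Nat.card_fun, Nat.card_zmod, Nat.card_fin, ← pow_mul, mul_comm, pow_mul]
    exact Nat.pow_le_pow_left (le_refl 4) n
  have hspan : ⊤ ≤ Submodule.span (ZMod (2 ^ n)) (Set.range ![P', Q']) := by
    rw [← Fintype.range_linearCombination, LinearMap.range_eq_top.2 hbij.2]
  exact ⟨Module.Basis.mk hli hspan, by simp [P'], by simp [Q']⟩

end EllipticGalois

/-! ### Generators of the image as Galois automorphisms. -/

namespace EllipticGalois

open WeierstrassCurve

variable {E : WeierstrassCurve ℚ} {N : ℕ} {ι : Type}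

lemma coe_matRep (b : Module.Basis (Fin 2) (ZMod N) (Tors E N)) (σ : GQ) :
    (matRep E N b σ : Matrix (Fin 2) (Fin 2) (ZMod N)) =
      LinearMap.toMatrixAlgEquiv b (torsRep E N σ) := rfl

lemma coe_torsRep (σ : GQ) (T : Tors E N) :
    (torsRep E N σ T : GeomPoint E) = galAct E σ T := rfl

/-- The matrix of a Galois automorphism is determined by its action on the basis points. -/
lemma coe_matRep_eq_iff (b : Module.Basis (Fin 2) (ZMod N) (Tors E N)) (σ : GQ)
    (m : Matrix (Fin 2) (Fin 2) ℤ) :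
    (matRep E N b σ : Matrix (Fin 2) (Fin 2) (ZMod N)) = m.map (Int.cast : ℤ → ZMod N) ↔
      ∀ j, galAct E σ (b j) = m 0 j • (b 0 : GeomPoint E) + m 1 j • (b 1 : GeomPoint E) := by
  have h : ∀ j, (galAct E σ (b j) = m 0 j • (b 0 : GeomPoint E) + m 1 j • (b 1 : GeomPoint E) ↔
      ∀ i, b.repr (torsRep E N σ (b j)) i = (m i j : ZMod N)) := by
    intro j
    rw [← coe_torsRep, ← coe_intCast_smul (N := N), ← coe_intCast_smul (N := N),
      ← AddSubgroup.coe_add, Subtype.coe_inj, ← b.repr.injective.eq_iff, Finsupp.ext_iff]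
    refine forall_congr' fun i => ?_
    fin_cases i <;> simp
  rw [← Matrix.ext_iff, forall_comm]
  refine forall_congr' fun j => ?_
  rw [h]
  refine forall_congr' fun i => ?_
  rw [coe_matRep, LinearMap.toMatrixAlgEquiv_apply, Matrix.map_apply]

lemma matRep_eq_iff (b : Module.Basis (Fin 2) (ZMod N) (Tors E N)) (σ τ : GQ) :
    matRep E N b σ = matRep E N b τ ↔ ∀ j, galAct E σ (b j) = galAct E τ (b j) := by
  rw [← Units.val_inj, coe_matRep, coe_matRep, (LinearMap.toMatrixAlgEquiv b).injective.eq_iff]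
  refine ⟨fun h j => by rw [← coe_torsRep, h, coe_torsRep], fun h => b.ext fun j => ?_⟩
  exact Subtype.ext (h j)

/-- The image of the representation is generated by the reductions of the matrices `M i` if and
only if these are the matrices of automorphisms that generate the Galois action on `E[N]`. -/
lemma isGeneratedBy_galImage_iff (b : Module.Basis (Fin 2) (ZMod N) (Tors E N))
    (M : ι → Matrix (Fin 2) (Fin 2) ℤ) :
    IsGeneratedBy N (galImage E N b) M ↔ ∃ σ : ι → GQ,
      (∀ i j, galAct E (σ i) (b j) =
        M i 0 j • (b 0 : GeomPoint E) + M i 1 j • (b 1 : GeomPoint E)) ∧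
      ∀ τ, ∃ τ' ∈ Subgroup.closure (Set.range σ), ∀ j, galAct E τ (b j) = galAct E τ' (b j) := by
  have hcl : ∀ σ : ι → GQ, Subgroup.closure (Set.range fun i => matRep E N b (σ i)) =
      (Subgroup.closure (Set.range σ)).map (matRep E N b) := fun σ => by
    rw [MonoidHom.map_closure, ← Set.range_comp]
    rfl
  -- The `σ i` generate the Galois group only modulo the kernel of the representation, hence
  -- agreement on the basis points rather than `τ = τ'`.
  constructor
  · rintro ⟨g, hg, hH⟩
    have hmem : ∀ i, g i ∈ galImage E N b := fun i =>
      hH ▸ Subgroup.subset_closure (Set.mem_range_self i)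
    choose σ hσ using hmem
    obtain rfl : (fun i => matRep E N b (σ i)) = g := funext hσ
    refine ⟨σ, fun i => (coe_matRep_eq_iff b _ _).1 (hg i), fun τ => ?_⟩
    have hτ : matRep E N b τ ∈ galImage E N b := ⟨τ, rfl⟩
    rw [hH, hcl] at hτ
    obtain ⟨τ', hτ', e⟩ := hτ
    exact ⟨τ', hτ', (matRep_eq_iff b _ _).1 e.symm⟩
  · rintro ⟨σ, hσ, hgen⟩
    refine ⟨fun i => matRep E N b (σ i), fun i => (coe_matRep_eq_iff b _ _).2 (hσ i), ?_⟩
    rw [hcl]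
    refine le_antisymm ?_ (by rintro _ ⟨τ, -, rfl⟩; exact ⟨τ, rfl⟩)
    rintro _ ⟨τ, rfl⟩
    obtain ⟨τ', hτ', e⟩ := hgen τ
    exact ⟨τ', hτ', ((matRep_eq_iff b _ _).2 e).symm⟩

/-- The images of the representation in two bases are conjugate. -/
lemma exists_map_conj_galImage_eq (b c : Module.Basis (Fin 2) (ZMod N) (Tors E N)) :
    ∃ g : GL (Fin 2) (ZMod N),
      (galImage E N c).map (MulAut.conj g).toMonoidHom = galImage E N b := by
  let g : GL (Fin 2) (ZMod N) := ⟨b.toMatrix c, c.toMatrix b, b.toMatrix_mul_toMatrix_flip c,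
    c.toMatrix_mul_toMatrix_flip b⟩
  have h : (MulAut.conj g).toMonoidHom.comp (matRep E N c) = matRep E N b := by
    ext1 σ
    refine Units.ext ?_
    exact basis_toMatrix_mul_linearMap_toMatrix_mul_basis_toMatrix b c b c (torsRep E N σ)
  exact ⟨g, by rw [galImage, galImage, MonoidHom.map_range, h]⟩

lemma HasImageConjTo.of_basis (b : Module.Basis (Fin 2) (ZMod N) (Tors E N))
    {M : ι → Matrix (Fin 2) (Fin 2) ℤ} (h : IsGeneratedBy N (galImage E N b) M) :
    HasImageConjTo E N M :=
  ⟨⟨b⟩, fun c => (exists_map_conj_galImage_eq b c).imp fun _ hg => by rwa [hg]⟩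

/-- A subgroup of `GL(2, ℤ/N)` is generated by the reductions of finitely many integer matrices. -/
lemma exists_isGeneratedBy [NeZero N] (H : Subgroup (GL (Fin 2) (ZMod N))) :
    ∃ (s : ℕ) (A B C D : Fin s → ℤ), IsGeneratedBy N H (fun i => !![A i, C i; B i, D i]) := by
  -- The group is finite, so all of its elements serve as generators.
  obtain ⟨s, ⟨e⟩⟩ := Finite.exists_equiv_fin H
  have hlift : ∀ x : ZMod N, ((x.cast : ℤ) : ZMod N) = x := ZMod.intCast_zmod_cast
  refine ⟨s, fun i => ((e.symm i).1 0 0).cast, fun i => ((e.symm i).1 1 0).cast,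
    fun i => ((e.symm i).1 0 1).cast, fun i => ((e.symm i).1 1 1).cast,
    fun i => (e.symm i).1, fun i => ?_, ?_⟩
  · ext j k
    fin_cases j <;> fin_cases k <;> simp [hlift]
  · have : Set.range (fun i => (e.symm i).1) = (H : Set (GL (Fin 2) (ZMod N))) := by
      rw [← Function.comp_def, e.symm.surjective.range_comp, Subtype.range_coe]
    rw [this, Subgroup.closure_eq]

end EllipticGalois

/-! ### Isogenies, quotients and change of basis. -/

namespace EllipticGalois

open WeierstrassCurve

variable {E E' : WeierstrassCurve ℚ}

lemma projCoords_galAct (σ : GQ) (P : GeomPoint E) (i : Fin 3) :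
    projCoords E (galAct E σ P) i = σ (projCoords E P i) := by
  rcases P with _ | ⟨x, y, h⟩
  · change (![0, 1, 0] : Fin 3 → QBar) i = σ ((![0, 1, 0] : Fin 3 → QBar) i)
    fin_cases i <;> simp
  · change (![σ x, σ y, 1] : Fin 3 → QBar) i = σ ((![x, y, 1] : Fin 3 → QBar) i)
    fin_cases i <;> simp

/-- The coordinates are normalised by an entry `1`, which forces `c = 1`. -/
lemma eq_of_projCoords_eq_mul {P Q : GeomPoint E} {c : QBar}
    (h : ∀ i, projCoords E P i = c * projCoords E Q i) : P = Q := by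
  have h0 := h 0
  have h1 := h 1
  have h2 := h 2
  rcases P with _ | ⟨x, y, hP⟩ <;> rcases Q with _ | ⟨x', y', hQ⟩
  · rfl
  · simp only [projCoords, Matrix.cons_val, Matrix.cons_val_one, Matrix.cons_val_zero] at h1 h2
    rw [mul_one] at h2
    rw [← h2, zero_mul] at h1
    exact absurd h1 one_ne_zero
  · simp [projCoords] at h2
  · simp only [projCoords, Matrix.cons_val, Matrix.cons_val_one, Matrix.cons_val_zero] at h0 h1 h2
    rw [mul_one] at h2
    subst h2
    rw [one_mul] at h0 h1
    subst h0 h1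
    rfl

/-- A morphism defined over the rationals commutes with the Galois action. -/
lemma IsMorphism.map_galAct {f : GeomPoint E → GeomPoint E'} (hf : IsMorphism E E' f)
    (σ : GQ) (P : GeomPoint E) : f (galAct E σ P) = galAct E' σ (f P) := by
  obtain ⟨d, F, -, ⟨k, hk⟩, hF⟩ := hf P
  -- The coefficients are rational, so `F (σ P) = σ (F P)`. The same `F` therefore computes `f` at
  -- both `P` and `σ P`.
  have hσ : ∀ i, MvPolynomial.aeval (projCoords E (galAct E σ P)) (F i) =
      σ (MvPolynomial.aeval (projCoords E P) (F i)) := fun i => by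
    rw [funext (projCoords_galAct σ P)]
    exact (MvPolynomial.comp_aeval_apply _ (σ : QBar →ₐ[ℚ] QBar) (F i)).symm
  have hk' : MvPolynomial.aeval (projCoords E (galAct E σ P)) (F k) ≠ 0 := by
    rw [hσ]
    exact (map_ne_zero σ).2 hk
  obtain ⟨c, hc⟩ := hF P ⟨k, hk⟩
  obtain ⟨c', hc'⟩ := hF _ ⟨k, hk'⟩
  have hc0 : c' ≠ 0 := by
    rintro rfl
    exact hk' (by rw [hc', zero_mul])
  refine eq_of_projCoords_eq_mul (c := σ c / c') fun i => ?_
  have := hc' i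
  rw [hσ, hc, map_mul, ← projCoords_galAct] at this
  rw [div_mul_eq_mul_div, this, mul_div_cancel_left₀ _ hc0]

lemma dvd_of_basis_zsmul_add_zsmul_eq_zero {N : ℕ}
    (b : Module.Basis (Fin 2) (ZMod N) (Tors E N)) {s t : ℤ}
    (h : s • (b 0 : GeomPoint E) + t • (b 1 : GeomPoint E) = 0) : (N : ℤ) ∣ s ∧ (N : ℤ) ∣ t := by
  rw [← coe_intCast_smul (N := N), ← coe_intCast_smul (N := N), ← AddSubgroup.coe_add,
    ZeroMemClass.coe_eq_zero] at h
  have hli := LinearIndependent.pair_iff.1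
    (show LinearIndependent (ZMod N) ![b 0, b 1] by
      convert b.linearIndependent using 1
      ext i
      fin_cases i <;> rfl) _ _ h
  simpa only [ZMod.intCast_zmod_eq_zero_iff_dvd] using hli

lemma nsmul_basis {N : ℕ} (b : Module.Basis (Fin 2) (ZMod N) (Tors E N)) (i : Fin 2) :
    N • (b i : GeomPoint E) = 0 :=
  mem_Tors.1 (b i).2

/-- The mod-`2 ^ n` image of the quotient of `E` by `⟨2 ^ n Q⟩` in terms of the
mod-`2 ^ (n + 1)` image of `E` in the basis `{P, Q}`. -/
theorem hasImageConjTo_of_isQuotientBy {N M n : ℕ} (hM : M = 2 * N) (hN : N = 2 ^ n)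
    (b : Module.Basis (Fin 2) (ZMod M) (Tors E M))
    (hE' : IsQuotientBy E (AddSubgroup.zmultiples (N • (b 1 : GeomPoint E))) E')
    {ι : Type} {A B C D : ι → ℤ} (hC : ∀ i, Even (C i))
    (h : IsGeneratedBy M (galImage E M b) (fun i => !![A i, C i; B i, D i])) :
    HasImageConjTo E' N (fun i => !![A i, C i / 2; 2 * B i, D i]) := by
  subst hM
  obtain ⟨φ, hφ⟩ := hE'
  obtain ⟨b', hP', hQ'⟩ := exists_basis_of_independent E' hN
    (P := φ.toHom (2 • (b 0 : GeomPoint E))) (Q := φ.toHom (b 1 : GeomPoint E))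
    (by rw [← map_nsmul, ← mul_smul, mul_comm, nsmul_basis, map_zero])
    (by
      rw [← map_nsmul, ← AddMonoidHom.mem_ker, hφ]
      exact AddSubgroup.mem_zmultiples _)
    -- A relation on `E'` lifts to `2s P + t Q = k N Q`. Hence `2N` divides `2s` and `t - k N`, so
    -- `N` divides `s` and `t`.
    (fun s t hst => by
      rw [← map_zsmul, ← map_zsmul, ← map_add, ← AddMonoidHom.mem_ker, hφ,
        AddSubgroup.mem_zmultiples_iff] at hst
      obtain ⟨k, hk⟩ := hst
      have h0 : (s * 2) • (b 0 : GeomPoint E) + (t - k * N) • (b 1 : GeomPoint E) = 0 := by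
        rw [sub_smul, mul_smul, mul_smul, ofNat_zsmul, natCast_zsmul, hk]
        abel
      obtain ⟨h1, h2⟩ := dvd_of_basis_zsmul_add_zsmul_eq_zero b h0
      push_cast at h1 h2
      refine ⟨?_, ?_⟩
      · rw [mul_comm s] at h1
        exact (mul_dvd_mul_iff_left two_ne_zero).1 h1
      · exact (dvd_sub_left (Dvd.intro_left k rfl)).1 (dvd_of_mul_left_dvd h2))
  refine HasImageConjTo.of_basis b' ((isGeneratedBy_galImage_iff b' _).2 ?_)
  obtain ⟨σ, hσ, hgen⟩ := (isGeneratedBy_galImage_iff b _).1 h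
  have heq : ∀ τ T, galAct E' τ (φ.toHom T) = φ.toHom (galAct E τ T) := fun τ T =>
    (φ.isMorphism.map_galAct τ T).symm
  refine ⟨σ, fun i => ?_, fun τ => ?_⟩
  · have h0 := hσ i 0
    have h1 := hσ i 1
    obtain ⟨c, hc⟩ := hC i
    simp only [Matrix.of_apply, Matrix.cons_val', Matrix.cons_val_zero, Matrix.cons_val_one,
      Matrix.cons_val_fin_one] at h0 h1
    refine Fin.forall_fin_two.2 ⟨?_, ?_⟩
    · simp only [Matrix.of_apply, Matrix.cons_val', Matrix.cons_val_zero, Matrix.cons_val_one,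
        Matrix.cons_val_fin_one]
      rw [hP', hQ', heq, map_nsmul, h0, ← map_zsmul, ← map_zsmul, ← map_add]
      congr 1
      module
    · simp only [Matrix.of_apply, Matrix.cons_val', Matrix.cons_val_zero, Matrix.cons_val_one,
        Matrix.cons_val_fin_one]
      rw [hP', hQ', heq, h1, ← map_zsmul, ← map_zsmul, ← map_add, hc,
        show (c + c) / 2 = c by omega]
      congr 1
      module
  · obtain ⟨τ', hτ', e⟩ := hgen τ
    refine ⟨τ', hτ', Fin.forall_fin_two.2 ⟨?_, ?_⟩⟩
    · rw [hP', heq, heq, map_nsmul (galAct E τ), map_nsmul (galAct E τ'), e]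
    · rw [hQ', heq, heq, e]

/-- Change of basis for generators of the image. -/
lemma IsGeneratedBy.change_basis {N : ℕ} {ι : Type}
    (b c : Module.Basis (Fin 2) (ZMod N) (Tors E N)) {M M' : ι → Matrix (Fin 2) (Fin 2) ℤ}
    (m : Matrix (Fin 2) (Fin 2) ℤ)
    (hc : ∀ j, (c j : GeomPoint E) = m 0 j • (b 0 : GeomPoint E) + m 1 j • (b 1 : GeomPoint E))
    (hM : ∀ i, M i * m = m * M' i) (h : IsGeneratedBy N (galImage E N b) M) :
    IsGeneratedBy N (galImage E N c) M' := by
  rw [isGeneratedBy_galImage_iff] at h ⊢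
  obtain ⟨σ, hσ, hgen⟩ := h
  refine ⟨σ, fun i j => ?_, fun τ => ?_⟩
  · have h0 := congrFun (congrFun (hM i) 0) j
    have h1 := congrFun (congrFun (hM i) 1) j
    simp only [Matrix.mul_apply, Fin.sum_univ_two] at h0 h1
    rw [hc, hc, hc, map_add, map_zsmul, map_zsmul, hσ, hσ]
    -- The entries of `M i * m = m * M' i` compare the coefficients of the two old basis points.
    linear_combination (norm := module) h0 • (b 0 : GeomPoint E) + h1 • (b 1 : GeomPoint E)
  · obtain ⟨τ', hτ', e⟩ := hgen τ
    exact ⟨τ', hτ', fun j => by rw [hc, map_add, map_add, map_zsmul, map_zsmul, map_zsmul,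
      map_zsmul, e, e]⟩

/-- The basis `{m₀₀ P + m₁₀ Q, m₀₁ P + m₁₁ Q}` obtained from the basis `{P, Q}`. -/
lemma exists_basis_of_det_isUnit {N : ℕ} (b : Module.Basis (Fin 2) (ZMod N) (Tors E N))
    (m : Matrix (Fin 2) (Fin 2) ℤ) (hm : IsUnit m.det) :
    ∃ c : Module.Basis (Fin 2) (ZMod N) (Tors E N), ∀ j, (c j : GeomPoint E) =
      m 0 j • (b 0 : GeomPoint E) + m 1 j • (b 1 : GeomPoint E) := by
  have hm' : IsUnit (m.map (Int.castRingHom (ZMod N))).det := by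
    rw [← RingHom.mapMatrix_apply, ← RingHom.map_det]
    exact hm.map _
  let e := Matrix.toLinearEquiv b (m.map (Int.castRingHom (ZMod N))) hm'
  refine ⟨b.map e, fun j => ?_⟩
  have : b.map e j = (m 0 j : ZMod N) • b 0 + (m 1 j : ZMod N) • b 1 := by
    rw [Module.Basis.map_apply]
    change Matrix.toLin b b (m.map (Int.castRingHom (ZMod N))) (b j) = _
    rw [Matrix.toLin_self]
    simp
  rw [this, AddSubgroup.coe_add, coe_intCast_smul, coe_intCast_smul]

lemma galAct_eq_self_of_isRational {T : GeomPoint E} (hT : IsRational E T) (σ : GQ) :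
    galAct E σ T = T := by
  obtain ⟨T₀, rfl⟩ := hT
  rcases T₀ with _ | ⟨x, y, h⟩
  · rfl
  · change Affine.Point.map (W' := E) _ (Affine.Point.map (W' := E) _ _) = _
    rw [Affine.Point.map_map]
    congr 2
    exact AlgHom.ext fun q => σ.commutes q

lemma exists_two_pow_nsmul_eq [E.IsElliptic] (n : ℕ) (P : GeomPoint E) :
    ∃ T : GeomPoint E, 2 ^ n • T = P := by
  induction n with
  | zero => exact ⟨P, by simp⟩
  | succ n ih =>
    obtain ⟨T, rfl⟩ := ih
    have : (Affine.baseChange E QBar).IsElliptic :=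
      inferInstanceAs (E.map (algebraMap ℚ QBar)).IsElliptic
    obtain ⟨S, rfl⟩ := Affine.Point.exists_two_nsmul_eq T
    exact ⟨S, by rw [pow_succ, mul_smul]⟩

/-- If the Galois action fixes the points of order two `N P` and `N Q`, then the matrices
generating the image in the basis `{P, Q}` are trivial modulo two. -/
lemma parity_of_isGeneratedBy {N M : ℕ} [NeZero N] (hM : M = 2 * N) {ι : Type}
    (b : Module.Basis (Fin 2) (ZMod M) (Tors E M))
    (h0 : ∀ σ, galAct E σ (N • (b 0 : GeomPoint E)) = N • (b 0 : GeomPoint E))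
    (h1 : ∀ σ, galAct E σ (N • (b 1 : GeomPoint E)) = N • (b 1 : GeomPoint E))
    {A B C D : ι → ℤ}
    (h : IsGeneratedBy M (galImage E M b) (fun i => !![A i, C i; B i, D i])) (i : ι) :
    Odd (A i) ∧ Odd (D i) ∧ Even (B i) ∧ Even (C i) := by
  subst hM
  obtain ⟨σ, hσ, -⟩ := (isGeneratedBy_galImage_iff b _).1 h
  have hN0 : (N : ℤ) ≠ 0 := by exact_mod_cast NeZero.ne N
  have e0 := hσ i 0
  have e1 := hσ i 1
  simp only [Matrix.of_apply, Matrix.cons_val', Matrix.cons_val_zero, Matrix.cons_val_one,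
    Matrix.cons_val_fin_one] at e0 e1
  have f0 := h0 (σ i)
  have f1 := h1 (σ i)
  rw [map_nsmul, e0, ← sub_eq_zero] at f0
  rw [map_nsmul, e1, ← sub_eq_zero] at f1
  -- Independence modulo `2N` makes `2N` divide `N (A - 1)` and `N B`, that is, `A - 1` and `B` are
  -- even; `g1` does the same for `C` and `D - 1`.
  have g0 : (N * (A i - 1) : ℤ) • (b 0 : GeomPoint E) + (N * B i : ℤ) • (b 1 : GeomPoint E) = 0 := by
    rw [← f0]
    module
  have g1 : (N * C i : ℤ) • (b 0 : GeomPoint E) + (N * (D i - 1) : ℤ) • (b 1 : GeomPoint E) = 0 := by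
    rw [← f1]
    module
  have hdvd : ∀ x : ℤ, ((2 * N : ℕ) : ℤ) ∣ N * x → Even x := fun x hx => by
    rw [Nat.cast_mul, mul_comm, mul_dvd_mul_iff_left hN0] at hx
    exact even_iff_two_dvd.2 hx
  obtain ⟨a, b⟩ := dvd_of_basis_zsmul_add_zsmul_eq_zero b g0
  obtain ⟨c, d⟩ := dvd_of_basis_zsmul_add_zsmul_eq_zero _ g1
  refine ⟨?_, ?_, hdvd _ b, hdvd _ c⟩
  · simpa using (hdvd _ a).add_one
  · simpa using (hdvd _ d).add_one

end EllipticGalois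

/-! ### The three quotients at level `64`. -/

theorem mainTheorem5 (E : WeierstrassCurve ℚ) [E.IsElliptic]
    (hfull : ∀ T : EllipticGalois.GeomPoint E, 2 • T = 0 → EllipticGalois.IsRational E T)
    (P₂ Q₂ : EllipticGalois.GeomPoint E)
    (hP : addOrderOf P₂ = 2) (hQ : addOrderOf Q₂ = 2) (hPQ : P₂ ≠ Q₂) :
    (∃ b : Module.Basis (Fin 2) (ZMod 64) (EllipticGalois.Tors E 64),
      32 • (b 0 : EllipticGalois.GeomPoint E) = P₂ ∧
      32 • (b 1 : EllipticGalois.GeomPoint E) = Q₂) ∧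
    ∀ b : Module.Basis (Fin 2) (ZMod 64) (EllipticGalois.Tors E 64),
      32 • (b 0 : EllipticGalois.GeomPoint E) = P₂ →
      32 • (b 1 : EllipticGalois.GeomPoint E) = Q₂ →
      (∃ (s : ℕ) (A B C D : Fin s → ℤ),
        EllipticGalois.IsGeneratedBy 64 (EllipticGalois.galImage E 64 b)
          (fun i => !![A i, C i; B i, D i])) ∧
      ∀ (s : ℕ) (A B C D : Fin s → ℤ),
        EllipticGalois.IsGeneratedBy 64 (EllipticGalois.galImage E 64 b)
          (fun i => !![A i, C i; B i, D i]) →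
        (∀ i, Odd (A i) ∧ Odd (D i) ∧ Even (B i) ∧ Even (C i)) ∧
        (∀ (E' : WeierstrassCurve ℚ) [E'.IsElliptic],
          EllipticGalois.IsQuotientBy E (AddSubgroup.zmultiples Q₂) E' →
          EllipticGalois.HasImageConjTo E' 32
            (fun i => !![A i, C i / 2; 2 * B i, D i])) ∧
        (∀ (E' : WeierstrassCurve ℚ) [E'.IsElliptic],
          EllipticGalois.IsQuotientBy E (AddSubgroup.zmultiples P₂) E' →
          EllipticGalois.HasImageConjTo E' 32
            (fun i => !![D i, B i / 2; 2 * C i, A i])) ∧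
        (∀ (E' : WeierstrassCurve ℚ) [E'.IsElliptic],
          EllipticGalois.IsQuotientBy E (AddSubgroup.zmultiples (P₂ + Q₂)) E' →
          EllipticGalois.HasImageConjTo E' 32
            (fun i => !![A i - B i, (A i + C i - B i - D i) / 2; 2 * B i, B i + D i])) := by

  have hP2 : 2 • P₂ = 0 := hP ▸ addOrderOf_nsmul_eq_zero P₂
  have hQ2 : 2 • Q₂ = 0 := hQ ▸ addOrderOf_nsmul_eq_zero Q₂
  refine ⟨?_, fun b hb0 hb1 => ⟨EllipticGalois.exists_isGeneratedBy _, fun s A B C D hgen => ?_⟩⟩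
  · obtain ⟨P, rfl⟩ := EllipticGalois.exists_two_pow_nsmul_eq 5 P₂
    obtain ⟨Q, rfl⟩ := EllipticGalois.exists_two_pow_nsmul_eq 5 Q₂
    obtain ⟨b, hb0, hb1⟩ := EllipticGalois.exists_basis_of_independent E (N := 64) (n := 6)
      (by norm_num) (P := P) (Q := Q) (by rw [← hP2, ← mul_smul]; norm_num)
      (by rw [← hQ2, ← mul_smul]; norm_num)
      (fun s t => EllipticGalois.two_pow_dvd_of_zsmul_add_zsmul_eq_zero (k := 5) hP hQ hPQ)
    exact ⟨b, by rw [hb0]; norm_num, by rw [hb1]; norm_num⟩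
  have hpar := EllipticGalois.parity_of_isGeneratedBy (N := 32) rfl b
    (EllipticGalois.galAct_eq_self_of_isRational (hfull _ (by rwa [hb0])))
    (EllipticGalois.galAct_eq_self_of_isRational (hfull _ (by rwa [hb1]))) hgen
  refine ⟨hpar, fun E' _ hE' => ?_, fun E' _ hE' => ?_, fun E' _ hE' => ?_⟩
  · rw [← hb1] at hE'
    exact EllipticGalois.hasImageConjTo_of_isQuotientBy (N := 32) (n := 5) rfl (by norm_num) b hE'
      (fun i => (hpar i).2.2.2) hgen
  · obtain ⟨c, hc⟩ := EllipticGalois.exists_basis_of_det_isUnit b !![0, 1; 1, 0] (by simp)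
    refine EllipticGalois.hasImageConjTo_of_isQuotientBy (N := 32) (n := 5) rfl (by norm_num) c ?_
      (fun i => (hpar i).2.2.1) (hgen.change_basis b c _ hc fun i => ?_)
    · simpa [hc, hb0] using hE'
    · ext j k
      fin_cases j <;> fin_cases k <;> simp [Matrix.mul_apply]
  · obtain ⟨c, hc⟩ := EllipticGalois.exists_basis_of_det_isUnit b !![1, 1; 0, 1] (by simp)
    refine EllipticGalois.hasImageConjTo_of_isQuotientBy (N := 32) (n := 5) rfl (by norm_num) c ?_
      (C := fun i => A i + C i - B i - D i) (fun i => ?_)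
      (hgen.change_basis b c _ hc fun i => ?_)
    · simpa [hc, hb0, hb1, nsmul_add] using hE'
    · obtain ⟨h1, h2, h3, h4⟩ := hpar i
      exact ((h1.add_even h4).sub_even h3).sub_odd h2
    · ext j k
      fin_cases j <;> fin_cases k <;> simp [Matrix.mul_apply]
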